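/- Let $n\ge 1$ agents $a_1,\dots,a_n$ and a finite set $M=\{e_1,\dots,e_m\}$ of indivisible items be given, and let item $e_j$ have size $s_{i,j}$ with $0<s_{i,j}\le 1$ for agent $a_i$; write $s_i(S)=\sum_{e_j\in S}s_{i,j}$ for $S\subseteq M$. A $k$-partition of $S$ is a tuple $(S_1,\dots,S_k)$ of pairwise disjoint, possibly empty, sets with union $S$. Let $v_i(S)$ be the maximum integer $\tau\ge 0$ such that $\tau = 0$ or $S$ has a $\tau$-partition $(S_1,\dots,S_\tau)$ with $s_i(S_j)\ge 1$ for all $j$ (the number of unit bins that $a_i$ can cover with $S$), and let \[ \kappa_i=\max_{(X_1,\dots,X_n)}\ \min_{1\le j\le n} v_i(X_j), \] the maximum being over all $n$-partitions of $M$, be the maximin share of $a_i$. Then there exists a $\frac23$-CMMS allocation, that is, an $n$-partition $(A_1,\dots,A_n)$ of $M$ such that for every agent $a_i$ with $\kappa_i\ge 1$ the bundle $A_i$ has a $\kappa_i$-partition $(A_{i,1},\dots,A_{i,\kappa_i})$ with $s_i(A_{i,j})\ge\frac23$ for all $j$ (if $\kappa_i=0$, nothing is required of $A_i$). -/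

import Mathlib

/-- `P` is a `k`-partition of the item set `S`: the parts are pairwise disjoint and their union
is `S`. Parts may be empty. -/
def IsKPartition {m k : ℕ} (P : Fin k → Finset (Fin m)) (S : Finset (Fin m)) : Prop :=
  Finset.univ.biUnion P = S ∧ Pairwise fun j l => Disjoint (P j) (P l)

/-- A bin covering instance with `n` agents and `m` indivisible items. Every agent has bins of
capacity `1`, and `size i e` is the size of item `e` in the opinion of agent `i`. -/
structure BinCoveringInstance (n m : ℕ) where
  size : Fin n → Fin m → ℝ
  size_pos : ∀ i e, 0 < size i e
  size_le_one : ∀ i e, size i e ≤ 1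

namespace BinCoveringInstance

variable {n m : ℕ} (I : BinCoveringInstance n m)

/-- The total size `s_i(S)` of the bundle `S` for agent `i`. -/
def bundleSize (i : Fin n) (S : Finset (Fin m)) : ℝ := ∑ e ∈ S, I.size i e

/-- Agent `i` can partition `S` into `k` bundles, each of total size at least `α`.
For `k = 0` nothing is required (zero bins are always covered, even if `S` is nonempty). -/
def CanSplit (i : Fin n) (α : ℝ) (k : ℕ) (S : Finset (Fin m)) : Prop :=
  0 < k → ∃ P : Fin k → Finset (Fin m), IsKPartition P S ∧ ∀ j, α ≤ I.bundleSize i (P j)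

/-- The bin covering valuation `v_i(S)`: the maximum number of unit bins that agent `i` can cover
with the items of `S`. -/
noncomputable def value (i : Fin n) (S : Finset (Fin m)) : ℕ :=
  sSup {k : ℕ | I.CanSplit i 1 k S}

/-- The maximin share `κ_i = max_{(X_1,…,X_n)} min_j v_i(X_j)`, the maximum being over all
`n`-partitions of the set of all items. -/
noncomputable def mms (i : Fin n) : ℕ :=
  sSup {κ : ℕ | ∃ X : Fin n → Finset (Fin m),
    IsKPartition X Finset.univ ∧ κ = ⨅ j, I.value i (X j)}

/-- An allocation is an `n`-partition of the set of all items, `A i` being the bundle of agent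
`i`; it is `α`-CMMS if every agent `i` can partition `A i` into `κ_i` bundles, each of total size
at least `α`. -/
def IsCMMSAllocation (α : ℝ) (A : Fin n → Finset (Fin m)) : Prop :=
  IsKPartition A Finset.univ ∧ ∀ i, I.CanSplit i α (I.mms i) (A i)

/-- The maximum in the definition of `value` is attained. -/
theorem isGreatest_value (i : Fin n) (S : Finset (Fin m)) :
    IsGreatest {k : ℕ | I.CanSplit i 1 k S} (I.value i S) := by
  have hne : {k : ℕ | I.CanSplit i 1 k S}.Nonempty := ⟨0, fun h => absurd h (lt_irrefl 0)⟩
  have hb : BddAbove {k : ℕ | I.CanSplit i 1 k S} := by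
    refine ⟨S.card, fun k hk => ?_⟩
    rcases Nat.eq_zero_or_pos k with rfl | hpos
    · exact Nat.zero_le _
    obtain ⟨P, ⟨hU, hD⟩, hs⟩ := hk hpos
    rw [← hU, Finset.card_biUnion fun j _ l _ hjl => hD hjl]
    calc k = ∑ _j : Fin k, 1 := by simp
      _ ≤ ∑ j : Fin k, (P j).card := by
        refine Finset.sum_le_sum fun j _ => Finset.card_pos.2 ?_
        rw [Finset.nonempty_iff_ne_empty]
        intro h
        have h1 := hs j
        rw [h] at h1
        simp only [bundleSize, Finset.sum_empty] at h1
        linarith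
  exact ⟨Nat.sSup_mem hne hb, fun k hk => le_csSup hb hk⟩

/-- The maximum in the definition of `mms` is attained. -/
theorem isGreatest_mms (i : Fin n) :
    IsGreatest {κ : ℕ | ∃ X : Fin n → Finset (Fin m),
      IsKPartition X Finset.univ ∧ κ = ⨅ j, I.value i (X j)} (I.mms i) := by
  have hne : {κ : ℕ | ∃ X : Fin n → Finset (Fin m),
      IsKPartition X Finset.univ ∧ κ = ⨅ j, I.value i (X j)}.Nonempty := by
    refine ⟨_, fun j => if j = i then Finset.univ else ∅, ⟨?_, ?_⟩, rfl⟩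
    · ext e
      simp only [Finset.mem_biUnion, Finset.mem_univ, true_and, iff_true]
      exact ⟨i, by simp⟩
    · intro j l hjl
      by_cases hj : j = i
      · have hl : l ≠ i := fun h => hjl (hj.trans h.symm)
        simp [hl]
      · simp [hj]
  have hfin : {κ : ℕ | ∃ X : Fin n → Finset (Fin m),
      IsKPartition X Finset.univ ∧ κ = ⨅ j, I.value i (X j)}.Finite := by
    refine (Set.finite_range fun X : Fin n → Finset (Fin m) => ⨅ j, I.value i (X j)).subset ?_
    rintro κ ⟨X, -, rfl⟩
    exact ⟨X, rfl⟩
  exact ⟨Nat.sSup_mem hne hfin.bddAbove, fun k hk => le_csSup hfin.bddAbove hk⟩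

end BinCoveringInstance

/-! Only positions in a sorted list matter: if the owner of each position `p` receives an item at
least as large as the `p`-th largest in the owner's own order, a division of positions yields a
division of items. Such an assignment exists by Hall's theorem (`exists_perm_le`), so all agents may
be treated as ranking the items alike.

Take an agent with `c` large items (size at least 1/3) and `N` bins. The `min c (2 * N - c)` largest
items, the heads, start one bin each; other large items are paired, and a pair already reaches 2/3.
`IsSufficient` says that the small items could fill the head bins and the empty bins up to level 1;
the existence of `N` unit bins implies it (`IsSufficient.of_bins`). Filling greedily only to 2/3
never overflows a bin and tolerates a shortage of 1/3 (`exists_fill`).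

A bundle grows along the positions: first one column of a boustrophedon deal, which holds a fair
share of heads and of pairs, and from a position `D` on everything. The first agent able to cover
the required bins takes it. For every other agent who has reached the small items, the bundle lacked
more than 1/3 of its share one item earlier (`deficit_of_not_covers`), and the last item is smaller
than 1/3. So the rest stays sufficient for one agent fewer, and induction applies
(`exists_disjoint_covers`). -/

/-! ### Covering bins to level 2/3 -/

/-- The items of `S` can be labelled so that each of the labels `0, …, k - 1` receives total size
at least `2 / 3`. -/
def Covers {α : Type*} (s : α → ℝ) (S : Finset α) (k : ℕ) : Prop :=
  ∃ f : α → ℕ, ∀ j < k, 2 / 3 ≤ ∑ x ∈ S with f x = j, s x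

namespace Covers

variable {α : Type*} {s : α → ℝ} {S T : Finset α} {k l : ℕ}

theorem mono (hs : ∀ x, 0 ≤ s x) (hST : S ⊆ T) (h : Covers s S k) : Covers s T k := by
  obtain ⟨f, hf⟩ := h
  refine ⟨f, fun j hj => (hf j hj).trans ?_⟩
  exact Finset.sum_le_sum_of_subset_of_nonneg (Finset.filter_subset_filter _ hST)
    fun x _ _ => hs x

theorem union [DecidableEq α] (hST : Disjoint S T) (hS : Covers s S k) (hT : Covers s T l)
    (hs : ∀ x, 0 ≤ s x) : Covers s (S ∪ T) (k + l) := by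
  obtain ⟨f, hf⟩ := hS
  obtain ⟨g, hg⟩ := hT
  refine ⟨fun x => if x ∈ S then f x else k + g x, fun j hj => ?_⟩
  by_cases hjk : j < k
  · refine (hf j hjk).trans (Finset.sum_le_sum_of_subset_of_nonneg ?_ fun x _ _ => hs x)
    intro x hx
    rw [Finset.mem_filter] at hx ⊢
    exact ⟨Finset.mem_union_left _ hx.1, by simp [hx.1, hx.2]⟩
  · refine (hg (j - k) (by omega)).trans
      (Finset.sum_le_sum_of_subset_of_nonneg ?_ fun x _ _ => hs x)
    intro x hx
    rw [Finset.mem_filter] at hx ⊢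
    refine ⟨Finset.mem_union_right _ hx.1, ?_⟩
    have : x ∉ S := Finset.disjoint_right.1 hST hx.1
    simp only [this, if_false, hx.2]
    omega

/-- Items of size at least `1 / 3` cover one bin per pair. -/
theorem of_two_mul_le_card [DecidableEq α] (hs : ∀ x, 0 ≤ s x) (hS : ∀ x ∈ S, 1 / 3 ≤ s x)
    (hk : 2 * k ≤ S.card) : Covers s S k := by
  induction k generalizing S with
  | zero => exact ⟨fun _ => 0, fun j hj => absurd hj (Nat.not_lt_zero j)⟩
  | succ k ih =>
    obtain ⟨U, hU, hU2⟩ := Finset.exists_subset_card_eq (show 2 ≤ S.card by omega)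
    have h1 : Covers s (S \ U) k := by
      refine ih (fun x hx => hS x (Finset.sdiff_subset hx)) ?_
      rw [Finset.card_sdiff_of_subset hU]
      omega
    have h2 : Covers s U 1 := by
      refine ⟨fun _ => 0, fun j hj => ?_⟩
      have hj0 : j = 0 := by omega
      subst hj0
      have := Finset.card_nsmul_le_sum U s (1 / 3) fun x hx => hS x (hU hx)
      rw [hU2] at this
      simp only [Finset.filter_true]
      refine le_trans (by norm_num) this
    have := union Finset.sdiff_disjoint h1 h2 hs
    rwa [Finset.sdiff_union_of_subset hU] at this

theorem map {β : Type*} (e : β ↪ α) {S : Finset β} (h : Covers (fun x => s (e x)) S k) :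
    Covers s (S.map e) k := by
  classical
  obtain ⟨f, hf⟩ := h
  refine ⟨Function.extend e f 0, fun j hj => (hf j hj).trans_eq ?_⟩
  simp [Finset.sum_filter, e.injective.extend_apply]

end Covers

/-- Small items can be distributed over partially filled bins of level at most `1`, so that every
bin reaches level `2 / 3`, if their total size is within `1 / 3` of the total deficit. -/
theorem exists_fill {α : Type*} [DecidableEq α] {s : α → ℝ} (hs : ∀ x, 0 ≤ s x) (k : ℕ)
    (Z : Finset α) : ∀ b : ℕ → ℝ, (∀ x ∈ Z, s x < 1 / 3) → (∀ j < k, b j ≤ 1) →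
    ∑ j ∈ Finset.range k, (1 - b j) ≤ ∑ x ∈ Z, s x + 1 / 3 →
    ∃ f : α → ℕ, ∀ j < k, 2 / 3 ≤ b j + ∑ x ∈ Z with f x = j, s x := by
  induction Z using Finset.induction_on with
  | empty =>
    intro b _ hb hsum
    refine ⟨fun _ => 0, fun j hj => ?_⟩
    have := Finset.single_le_sum (f := fun j => 1 - b j) (s := Finset.range k)
      (fun i hi => sub_nonneg.2 (hb i (Finset.mem_range.1 hi))) (Finset.mem_range.2 hj)
    simp only [Finset.sum_empty] at hsum
    simp only [Finset.filter_empty, Finset.sum_empty]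
    linarith
  | insert x Z hx ih =>
    intro b hZ hb hsum
    by_cases hall : ∀ j < k, 2 / 3 ≤ b j
    · exact ⟨fun _ => 0, fun j hj =>
        (hall j hj).trans (le_add_of_nonneg_right (Finset.sum_nonneg fun y _ => hs y))⟩
    · push Not at hall
      -- Put `x` into a bin below 2/3: the level stays below 1 because `x` is smaller than 1/3, so
      -- its whole size reduces the deficit.
      obtain ⟨i, hi, hbi⟩ := hall
      have hxs := hZ x (Finset.mem_insert_self x Z)
      have hsum' : ∑ j ∈ Finset.range k, (1 - (b j + if j = i then s x else 0)) =
          ∑ j ∈ Finset.range k, (1 - b j) - s x := by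
        simp_rw [← sub_sub]
        rw [Finset.sum_sub_distrib, Finset.sum_ite_eq' (Finset.range k) i]
        simp [hi]
      obtain ⟨f, hf⟩ := ih (fun j => b j + if j = i then s x else 0)
        (fun y hy => hZ y (Finset.mem_insert_of_mem hy))
        (fun j hj => by
          have := hb j hj
          split_ifs with h
          · subst h; linarith
          · linarith)
        (by
          rw [hsum']
          rw [Finset.sum_insert hx] at hsum
          linarith)
      refine ⟨Function.update f x i, fun j hj => (hf j hj).trans_eq ?_⟩
      rw [Finset.sum_filter, Finset.sum_filter, Finset.sum_insert hx, add_assoc]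
      congr 2
      · simp [eq_comm]
      · refine Finset.sum_congr rfl fun y hy => ?_
        rw [Function.update_of_ne (ne_of_mem_of_not_mem hy hx)]

/-- At most `k` large items `H` together with small items `Z` cover `k` bins if the small items
make up for the total deficit of the bins up to `1 / 3`. -/
theorem Covers.of_deficit_le {s : ℕ → ℝ} (hs : ∀ x, 0 ≤ s x) (hs1 : ∀ x, s x ≤ 1)
    {H Z : Finset ℕ} (hHZ : Disjoint H Z) (hZ : ∀ x ∈ Z, s x < 1 / 3) {k : ℕ} (hk : H.card ≤ k)
    (h : ∑ x ∈ H, (1 - s x) + (k - H.card : ℕ) ≤ ∑ x ∈ Z, s x + 1 / 3) :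
    Covers s (H ∪ Z) k := by
  -- `g` ranks the items of `H`, so every bin starts with at most one of them; `k - H.card` bins
  -- start empty.
  set g : ℕ → ℕ := fun x => (H.filter (· < x)).card with hg
  have hlt : ∀ x ∈ H, g x < k := fun x hx => by
    refine lt_of_lt_of_le (Finset.card_lt_card ?_) hk
    rw [Finset.filter_ssubset]
    exact ⟨x, hx, lt_irrefl x⟩
  have hinj : ∀ x ∈ H, ∀ y ∈ H, g x = g y → x = y := by
    have key : ∀ x ∈ H, ∀ y, x < y → g x < g y := fun x hx y hxy => by
      refine Finset.card_lt_card ((Finset.ssubset_iff_of_subset ?_).2 ⟨x, ?_, ?_⟩)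
      · exact Finset.monotone_filter_right _ fun z _ hz => lt_trans hz hxy
      · simp [hx, hxy]
      · simp
    intro x hx y hy hxy
    rcases lt_trichotomy x y with h | h | h
    · exact absurd hxy (key x hx y h).ne
    · exact h
    · exact absurd hxy (key y hy x h).ne'
  have hb : ∀ j < k, ∑ x ∈ H with g x = j, s x ≤ 1 := fun j _ => by
    have hc : (H.filter (g · = j)).card ≤ 1 := Finset.card_le_one.2 fun x hx y hy => by
      rw [Finset.mem_filter] at hx hy
      exact hinj x hx.1 y hy.1 (hx.2.trans hy.2.symm)
    refine (Finset.sum_le_card_nsmul _ _ 1 fun x _ => hs1 x).trans ?_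
    simpa using hc
  obtain ⟨f, hf⟩ := exists_fill hs k Z (fun j => ∑ x ∈ H with g x = j, s x) hZ hb (by
    rw [Finset.sum_sub_distrib, Finset.sum_fiberwise_of_maps_to
      (fun x hx => Finset.mem_range.2 (hlt x hx))]
    rw [Finset.sum_sub_distrib] at h
    push_cast [hk] at h
    simp only [Finset.sum_const, Finset.card_range, nsmul_eq_mul, mul_one] at h ⊢
    linarith)
  refine ⟨fun x => if x ∈ H then g x else f x, fun j hj => (hf j hj).trans_eq ?_⟩
  simp only [Finset.sum_filter]
  rw [Finset.sum_union hHZ]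
  congr 1
  · exact Finset.sum_congr rfl fun x hx => by simp [hx]
  · exact Finset.sum_congr rfl fun x hx => by simp [Finset.disjoint_right.1 hHZ hx]

/-! ### Profiles and sufficiency -/

/-- Item sizes in nonincreasing order, with values in `[0, 1]`, extended by zero beyond the first
`m` items. -/
structure IsProfile (s : ℕ → ℝ) (m : ℕ) : Prop where
  anti : Antitone s
  nonneg : ∀ x, 0 ≤ s x
  le_one : ∀ x, s x ≤ 1
  eq_zero : ∀ x, m ≤ x → s x = 0

/-- Let `c` be the number of items of size at least `1 / 3`. If bins are formed from
the `min c (2 * N - c)` largest items, and the remaining items of size at least `1 / 3` are paired,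
then the items of size less than `1 / 3` suffice to fill the bins up to level `1`, where `N` is
the total number of bins. -/
def IsSufficient (s : ℕ → ℝ) (m N c : ℕ) : Prop :=
  (∀ x, x < c ↔ 1 / 3 ≤ s x) ∧
    ((N - c : ℕ) : ℝ) + ∑ x ∈ Finset.range (min c (2 * N - c)), (1 - s x) ≤
      ∑ x ∈ Finset.Ico c m, s x

theorem IsProfile.exists_threshold {s : ℕ → ℝ} {m : ℕ} (hs : IsProfile s m) :
    ∃ c, ∀ x, x < c ↔ 1 / 3 ≤ s x := by
  have hex : ∃ x, ¬ 1 / 3 ≤ s x := ⟨m, by rw [hs.eq_zero m le_rfl]; norm_num⟩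
  classical
  refine ⟨Nat.find hex, fun x => ⟨fun hx => not_not.1 (Nat.find_min hex hx), fun hx => ?_⟩⟩
  by_contra hlt
  exact Nat.find_spec hex (hx.trans (hs.anti (not_lt.1 hlt)))

theorem IsProfile.threshold_le {s : ℕ → ℝ} {m c : ℕ} (hs : IsProfile s m)
    (hc : ∀ x, x < c ↔ 1 / 3 ≤ s x) : c ≤ m := by
  by_contra h
  have := (hc m).1 (not_le.1 h)
  rw [hs.eq_zero m le_rfl] at this
  norm_num at this

/-- A single bin of total size at least `1`: its small items, plus the excess of its items over
`θ`, against the number of its large items. -/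
theorem bin_deficit_le {s : ℕ → ℝ} {m c h : ℕ} (hs : IsProfile s m) (hhc : h ≤ c) {θ : ℝ}
    (hθ : 1 / 2 ≤ θ) (hθ1 : θ ≤ 1) (hge : ∀ x < h, θ ≤ s x) (hle : ∀ x, h ≤ x → s x ≤ θ)
    {Q : Finset ℕ} (hQ : 1 ≤ ∑ x ∈ Q, s x) :
    (2 - ((Q.filter (· < c)).card : ℝ)) * (1 - θ) ≤
      ∑ x ∈ Q with ¬ x < c, s x + ∑ x ∈ Q with x < h, (s x - θ) := by
  set d := (Q.filter (· < c)).card with hd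
  have hsplit := Finset.sum_filter_add_sum_filter_not Q (· < c) s
  have h1 : 0 ≤ ∑ x ∈ Q with ¬ x < c, s x := Finset.sum_nonneg fun x _ => hs.nonneg x
  have h2 : 0 ≤ ∑ x ∈ Q with x < h, (s x - θ) := Finset.sum_nonneg fun x hx =>
    sub_nonneg.2 (hge x (Finset.mem_filter.1 hx).2)
  have h3 : ∑ x ∈ Q with x < c, s x ≤ d * θ + ∑ x ∈ Q with x < h, (s x - θ) := by
    have h4 : ∑ x ∈ Q with x < c, (s x - θ) ≤ ∑ x ∈ Q with x < h, (s x - θ) := by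
      rw [Finset.sum_filter, Finset.sum_filter]
      refine Finset.sum_le_sum fun x _ => ?_
      by_cases hxh : x < h
      · simp [hxh, hxh.trans_le hhc]
      · have := hle x (not_lt.1 hxh)
        split_ifs <;> linarith
    rw [Finset.sum_sub_distrib, Finset.sum_const, nsmul_eq_mul] at h4
    linarith
  -- It remains to compare `(2 - d)(1 - θ)` with `1 - dθ`: `d = 0` needs `θ ≥ 1/2`, `d = 1` gives
  -- equality, and for `d ≥ 2` the left side of the goal is nonpositive.
  rcases Nat.lt_or_ge d 2 with h5 | h5
  · interval_cases hdd : d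
    · simp only [Nat.cast_zero] at h3 ⊢; linarith
    · simp only [Nat.cast_one] at h3 ⊢; linarith
  · have h6 : (2 : ℝ) ≤ d := by exact_mod_cast h5
    nlinarith

/-- If the items contain `N` disjoint bins of total size at least `1`, they are sufficient for `N`
bins. -/
theorem IsSufficient.of_bins {s : ℕ → ℝ} {m c : ℕ} (hs : IsProfile s m)
    (hc : ∀ x, x < c ↔ 1 / 3 ≤ s x) {ι : Type*} [Fintype ι] (Q : ι → Finset ℕ)
    (hQd : Pairwise fun i j => Disjoint (Q i) (Q j)) (hQm : ∀ i, Q i ⊆ Finset.range m)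
    (hQ : ∀ i, 1 ≤ ∑ x ∈ Q i, s x) : IsSufficient s m (Fintype.card ι) c := by
  classical
  refine ⟨hc, ?_⟩
  set N := Fintype.card ι with hN
  have hcm : c ≤ m := hs.threshold_le hc
  have hunion : ∀ g : ℕ → ℝ, (∀ x, 0 ≤ g x) →
      ∑ i, ∑ x ∈ Q i, g x ≤ ∑ x ∈ Finset.range m, g x := fun g hg => by
    rw [← Finset.sum_biUnion fun i _ j _ hij => hQd hij]
    refine Finset.sum_le_sum_of_subset_of_nonneg ?_ fun x _ _ => hg x
    exact Finset.biUnion_subset.2 fun i _ => hQm i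
  have htotal : (N : ℝ) ≤ ∑ x ∈ Finset.range m, s x := by
    refine le_trans ?_ (hunion s hs.nonneg)
    have := Finset.card_nsmul_le_sum Finset.univ (fun i => ∑ x ∈ Q i, s x) 1 fun i _ => hQ i
    simpa [hN] using this
  have hsplit : ∑ x ∈ Finset.range c, s x + ∑ x ∈ Finset.Ico c m, s x =
      ∑ x ∈ Finset.range m, s x := Finset.sum_range_add_sum_Ico s hcm
  rcases le_or_gt c N with hcN | hcN
  · rw [min_eq_left (by omega)]
    push_cast [hcN]
    rw [Finset.sum_sub_distrib]
    simp only [Finset.sum_const, Finset.card_range, nsmul_eq_mul, mul_one]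
    linarith
  rcases le_or_gt (2 * N) c with hc2 | hc2
  · rw [show N - c = 0 by omega, show min c (2 * N - c) = 0 by omega]
    simp only [Nat.cast_zero, Finset.range_zero, Finset.sum_empty, add_zero]
    exact Finset.sum_nonneg fun x _ => hs.nonneg x
  obtain ⟨h, hh⟩ : ∃ h, 2 * N - c = h + 1 := ⟨2 * N - c - 1, by omega⟩
  rw [show N - c = 0 by omega, min_eq_right (by omega), hh]
  have hhR : (2 * N : ℝ) - c = h + 1 := by
    have : 2 * N = c + (h + 1) := by omega
    have : (2 * N : ℝ) = c + (h + 1) := by exact_mod_cast this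
    linarith
  simp only [Nat.cast_zero, zero_add]
  rcases le_or_gt (1 / 2) (s h) with hθ | hθ
  -- Sum the single-bin bound with `θ = s h`, the smallest head. The bins contain at most `c` large
  -- items altogether, so the left side is at least `(h + 1)(1 - s h)`.
  · have hbins := Finset.sum_le_sum fun i (_ : i ∈ (Finset.univ : Finset ι)) =>
      bin_deficit_le (c := c) (h := h + 1) hs (by omega) hθ (hs.le_one h)
        (fun x hx => hs.anti (Nat.lt_succ_iff.1 hx)) (fun x hx => hs.anti (by omega)) (hQ i)
    rw [Finset.sum_add_distrib, ← Finset.sum_mul, Finset.sum_sub_distrib] at hbins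
    simp only [Finset.sum_filter] at hbins
    have h1 := hunion (fun x => if ¬ x < c then s x else 0) fun x => by
      split_ifs <;> simp [hs.nonneg x]
    have h2 := hunion (fun x => if x < h + 1 then s x - s h else 0) fun x => by
      split_ifs with hx
      · exact sub_nonneg.2 (hs.anti (Nat.lt_succ_iff.1 hx))
      · exact le_rfl
    have h3 := hunion (fun x => if x < c then 1 else 0) fun x => by
      split_ifs <;> simp
    rw [← Finset.sum_filter, show (Finset.range m).filter (¬ · < c) = Finset.Ico c m by
      ext x; simp only [Finset.mem_filter, Finset.mem_range, Finset.mem_Ico]; omega] at h1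
    rw [← Finset.sum_filter, show (Finset.range m).filter (· < h + 1) = Finset.range (h + 1) by
      ext x; simp only [Finset.mem_filter, Finset.mem_range]; omega] at h2
    rw [← Finset.sum_filter, show (Finset.range m).filter (· < c) = Finset.range c by
      ext x; simp only [Finset.mem_filter, Finset.mem_range]; omega] at h3
    rw [Finset.sum_sub_distrib] at h2 ⊢
    simp only [Finset.sum_const, Finset.card_range, nsmul_eq_mul, mul_one, Finset.card_univ,
      Finset.sum_boole, ← hN] at hbins h1 h2 h3 ⊢
    have h4 : ((h : ℝ) + 1) * (1 - s h) ≤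
        (N * 2 - ∑ i, (((Q i).filter (· < c)).card : ℝ)) * (1 - s h) :=
      mul_le_mul_of_nonneg_right (by linarith) (sub_nonneg.2 (hs.le_one h))
    push_cast at h2 ⊢
    linarith
  -- The `2(c - N)` paired items have size at most 1/2 here, so they use at most `c - N` of the
  -- total size, which is at least `N`.
  · have h1 : ∑ x ∈ Finset.range (h + 1), s x + ∑ x ∈ Finset.Ico (h + 1) c, s x =
        ∑ x ∈ Finset.range c, s x := Finset.sum_range_add_sum_Ico s (by omega)
    have h2 : ∑ x ∈ Finset.Ico (h + 1) c, s x ≤ (Finset.Ico (h + 1) c).card • (1 / 2 : ℝ) :=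
      Finset.sum_le_card_nsmul _ _ _ fun x hx =>
        (hs.anti (by have := (Finset.mem_Ico.1 hx).1; omega)).trans hθ.le
    rw [Nat.card_Ico, nsmul_eq_mul, Nat.cast_sub (by omega)] at h2
    rw [Finset.sum_sub_distrib]
    simp only [Finset.sum_const, Finset.card_range, nsmul_eq_mul, mul_one]
    push_cast at h2 ⊢
    linarith

/-! ### Deleting a bundle and renumbering the rest -/

section Reindex

variable (S : Finset ℕ)

/-- Infinitude makes `Nat.nth` an increasing enumeration of the whole complement that never falls
back to its default value. -/
theorem infinite_setOf_notMem : (Set.ofPred fun x => x ∉ S).Infinite := S.finite_toSet.infinite_compl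

theorem count_notMem_add_card (b : ℕ) :
    Nat.count (· ∉ S) b + (S.filter (· < b)).card = b := by
  rw [Nat.count_eq_card_filter_range]
  have h : S.filter (· < b) = (Finset.range b).filter (· ∈ S) := by
    ext x; simp [and_comm]
  rw [h, add_comm, Finset.card_filter_add_card_filter_not, Finset.card_range]

theorem sum_Ico_count_notMem (g : ℕ → ℝ) (a b : ℕ) :
    ∑ x ∈ Finset.Ico (Nat.count (· ∉ S) a) (Nat.count (· ∉ S) b), g (Nat.nth (· ∉ S) x) =
      ∑ y ∈ Finset.Ico a b with y ∉ S, g y := by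
  have hinf := infinite_setOf_notMem S
  refine Finset.sum_nbij' (Nat.nth (· ∉ S)) (Nat.count (· ∉ S)) ?_ ?_ ?_ ?_ ?_
  · intro x hx
    rw [Finset.mem_Ico] at hx
    rw [Finset.mem_filter, Finset.mem_Ico]
    exact ⟨⟨(Nat.count_le_iff_le_nth hinf).1 hx.1, (Nat.lt_nth_iff_count_lt hinf).1 hx.2⟩,
      Nat.nth_mem_of_infinite hinf x⟩
  · intro y hy
    rw [Finset.mem_filter, Finset.mem_Ico] at hy
    rw [Finset.mem_Ico]
    exact ⟨Nat.count_monotone _ hy.1.1, Nat.count_strict_mono hy.2 hy.1.2⟩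
  · exact fun x _ => Nat.count_nth_of_infinite hinf x
  · exact fun y hy => Nat.nth_count (Finset.mem_filter.1 hy).2
  · exact fun _ _ => rfl

theorem sum_range_count_notMem (g : ℕ → ℝ) (b : ℕ) :
    ∑ x ∈ Finset.range (Nat.count (· ∉ S) b), g (Nat.nth (· ∉ S) x) =
      ∑ y ∈ Finset.range b with y ∉ S, g y := by
  have := sum_Ico_count_notMem S g 0 b
  rwa [Nat.count_zero, ← Finset.range_eq_Ico, ← Finset.range_eq_Ico] at this

theorem IsProfile.comp_nth {s : ℕ → ℝ} {m : ℕ} (hs : IsProfile s m) :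
    IsProfile (fun x => s (Nat.nth (· ∉ S) x)) (Nat.count (· ∉ S) m) where
  anti := hs.anti.comp_monotone (Nat.nth_monotone (infinite_setOf_notMem S))
  nonneg _ := hs.nonneg _
  le_one _ := hs.le_one _
  eq_zero _ hx := hs.eq_zero _ ((Nat.count_le_iff_le_nth (infinite_setOf_notMem S)).1 hx)

variable {S}

/-- Removing the items of `S` keeps the remaining items sufficient for `N'` bins if `S` does not
use up more than its share. -/
theorem IsSufficient.comp_nth {s : ℕ → ℝ} {m N c N' : ℕ} (hs : IsProfile s m)
    (hc : IsSufficient s m N c) {h : ℕ} (hh : h = min c (2 * N - c))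
    (hheads : min (Nat.count (· ∉ S) c) (2 * N' - Nat.count (· ∉ S) c) ≤ Nat.count (· ∉ S) h)
    (hS : ∑ x ∈ S with c ≤ x, s x + (N' - Nat.count (· ∉ S) c : ℕ) ≤
      ∑ x ∈ S with x < h, (1 - s x) + (N - c : ℕ)) :
    IsSufficient (fun x => s (Nat.nth (· ∉ S) x)) (Nat.count (· ∉ S) m) N'
      (Nat.count (· ∉ S) c) := by
  obtain ⟨hthr, hsum⟩ := hc
  rw [← hh] at hsum
  refine ⟨fun x => ?_, ?_⟩
  · rw [Nat.lt_nth_iff_count_lt (infinite_setOf_notMem S), hthr]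
  rw [sum_Ico_count_notMem]
  -- By `hheads` the new heads are among the old heads outside `S`.
  have h1 : ∑ x ∈ Finset.range (min (Nat.count (· ∉ S) c) (2 * N' - Nat.count (· ∉ S) c)),
      (1 - s (Nat.nth (· ∉ S) x)) ≤ ∑ y ∈ Finset.range h with y ∉ S, (1 - s y) := by
    rw [← sum_range_count_notMem S (fun y => 1 - s y)]
    exact Finset.sum_le_sum_of_subset_of_nonneg (Finset.range_mono hheads)
      fun x _ _ => sub_nonneg.2 (hs.le_one _)
  have h2 := Finset.sum_filter_add_sum_filter_not (Finset.range h) (· ∈ S) (fun y => 1 - s y)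
  have h3 := Finset.sum_filter_add_sum_filter_not (Finset.Ico c m) (· ∈ S) s
  have h4 : (Finset.range h).filter (· ∈ S) = S.filter (· < h) := by
    ext x; simp [and_comm]
  have h5 : ∑ x ∈ Finset.Ico c m with x ∈ S, s x ≤ ∑ x ∈ S with c ≤ x, s x := by
    refine Finset.sum_le_sum_of_subset_of_nonneg ?_ fun x _ _ => hs.nonneg x
    intro x hx
    simp only [Finset.mem_filter, Finset.mem_Ico] at hx ⊢
    exact ⟨hx.2, hx.1.1⟩
  rw [h4] at h2
  linarith

end Reindex

/-! ### The boustrophedon column -/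

/-- The first column of `n` columns into which items are dealt in boustrophedon order. -/
def IsSnake (n x : ℕ) : Prop := 2 * n ∣ x ∨ 2 * n ∣ x + 1

instance (n : ℕ) : DecidablePred (IsSnake n) := fun _ => inferInstanceAs (Decidable (_ ∨ _))

/-- The ceiling counts the positions congruent to 0 modulo `2 * n`, the floor those congruent to -1;
the two classes are disjoint as `2 * n > 1`. -/
theorem count_isSnake {n : ℕ} (hn : 0 < n) (x : ℕ) :
    Nat.count (IsSnake n) x = (x + (2 * n - 1)) / (2 * n) + x / (2 * n) := by
  induction x with
  | zero =>
    rw [Nat.count_zero, Nat.zero_div, Nat.div_eq_of_lt (by omega)]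
  | succ x ih =>
    rw [Nat.count_succ, ih, show x + 1 + (2 * n - 1) = x + (2 * n - 1) + 1 by omega, Nat.succ_div,
      Nat.succ_div (a := x)]
    have h1 : 2 * n ∣ x + (2 * n - 1) + 1 ↔ 2 * n ∣ x := by
      rw [show x + (2 * n - 1) + 1 = x + 2 * n by omega]
      exact Nat.dvd_add_self_right
    have h2 : 2 * n ∣ x → ¬ 2 * n ∣ x + 1 := fun h h' => by
      have := Nat.le_of_dvd one_pos ((Nat.dvd_add_right h).1 h')
      omega
    simp only [h1, IsSnake]
    by_cases ha : 2 * n ∣ x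
    · simp [ha, h2 ha]; omega
    · by_cases hb : 2 * n ∣ x + 1
      · simp [ha, hb]; omega
      · simp [ha, hb]

/-- The column is symmetric under the reflection `x ↦ 2nκ - 1 - x` and has two positions in each of
the `κ` blocks of length `2n`. This balances heads against pairs: `a = c` and `b = 2N - c`. -/
theorem count_isSnake_add_count {n κ a b : ℕ} (hn : 0 < n) (hab : a + b = 2 * (n * κ)) :
    Nat.count (IsSnake n) a + Nat.count (IsSnake n) b = 2 * κ := by
  have key : ∀ a b, a + b = 2 * (n * κ) → (a + (2 * n - 1)) / (2 * n) + b / (2 * n) = κ := by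
    intro a b hab
    have hb := Nat.div_add_mod b (2 * n)
    have hlt := Nat.mod_lt b (show 0 < 2 * n by omega)
    set q := b / (2 * n)
    set d := b % (2 * n)
    have hq : q ≤ κ := by
      by_contra h
      have : 2 * n * (κ + 1) ≤ 2 * n * q := Nat.mul_le_mul_left _ (by omega)
      have h2 : 2 * n * (κ + 1) = 2 * (n * κ) + 2 * n := by ring
      omega
    obtain ⟨p, rfl⟩ := Nat.exists_eq_add_of_le hq
    have ha : a + (2 * n - 1) = 2 * n - 1 - d + 2 * n * p := by
      have : 2 * (n * (q + p)) = 2 * n * q + 2 * n * p := by ring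
      omega
    rw [ha, Nat.add_mul_div_left _ _ (by omega), Nat.div_eq_of_lt (by omega)]
    omega
  rw [count_isSnake hn, count_isSnake hn]
  have h1 := key a b hab
  have h2 := key b a (by omega)
  omega

section Snake

variable {s : ℕ → ℝ} {m c n κ h : ℕ} {S : Finset ℕ}

theorem count_le_count_add {p : ℕ → Prop} [DecidablePred p] (a b : ℕ) :
    Nat.count p b ≤ Nat.count p a + (b - a) := by
  rcases le_total a b with hab | hab
  · obtain ⟨d, rfl⟩ := Nat.exists_eq_add_of_le hab
    rw [Nat.count_add, Nat.add_sub_cancel_left]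
    exact Nat.add_le_add_left (Nat.count_le _) _
  · exact (Nat.count_monotone p hab).trans (Nat.le_add_right _ _)

theorem card_filter_lt_of_eq_snake
    (hSc : S.filter (· < c) = (Finset.range c).filter (IsSnake n)) {b : ℕ} (hb : b ≤ c) :
    (S.filter (· < b)).card = Nat.count (IsSnake n) b := by
  rw [Nat.count_eq_card_filter_range]
  congr 1
  ext x
  have := Finset.ext_iff.1 hSc x
  simp only [Finset.mem_filter, Finset.mem_range] at this ⊢
  constructor
  · exact fun hx => ⟨hx.2, (this.1 ⟨hx.1, hx.2.trans_le hb⟩).2⟩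
  · exact fun hx => ⟨(this.2 ⟨hx.1.trans_le hb, hx.2⟩).1, hx.1⟩

theorem covers_of_snake_subset (hn : 0 < n) (hs : IsProfile s m)
    (hc : ∀ x, x < c ↔ 1 / 3 ≤ s x) (hc2 : 2 * (n * κ) ≤ c)
    (hS : (Finset.range (2 * (n * κ))).filter (IsSnake n) ⊆ S) : Covers s S κ := by
  refine Covers.mono hs.nonneg hS (Covers.of_two_mul_le_card hs.nonneg ?_ ?_)
  · intro x hx
    rw [Finset.mem_filter, Finset.mem_range] at hx
    exact (hc x).1 (hx.1.trans_le hc2)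
  · rw [← Nat.count_eq_card_filter_range]
    have := count_isSnake_add_count (κ := κ) hn (Nat.add_zero (2 * (n * κ)))
    rw [Nat.count_zero] at this
    omega

/-- A bundle whose large items form the snake column, and which does not cover `κ` bins, lacks
more than `1 / 3` of small items. -/
theorem deficit_of_not_covers (hn : 0 < n) (hs : IsProfile s m)
    (hc : ∀ x, x < c ↔ 1 / 3 ≤ s x) (hc2 : c < 2 * (n * κ)) (hh : h = min c (2 * (n * κ) - c))
    (hSc : S.filter (· < c) = (Finset.range c).filter (IsSnake n)) (hcov : ¬ Covers s S κ) :
    ∑ x ∈ S with c ≤ x, s x + 1 / 3 <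
      ∑ x ∈ S with x < h, (1 - s x) + (κ - Nat.count (IsSnake n) c : ℕ) := by
  by_contra hcon
  rw [not_lt] at hcon
  apply hcov
  have hhc : h ≤ c := by omega
  set r := Nat.count (IsSnake n) with hr
  have hmono : Monotone r := Nat.count_monotone _
  have hH : (S.filter (· < h)).card = r h := card_filter_lt_of_eq_snake hSc hhc
  have hC : (S.filter (· < c)).card = r c := card_filter_lt_of_eq_snake hSc le_rfl
  have hN : r (n * κ) + r (n * κ) = 2 * κ := count_isSnake_add_count hn (by omega)
  have hT : (S.filter fun x => h ≤ x ∧ x < c).card + r h = r c := by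
    rw [← hH, ← hC, ← Finset.card_union_of_disjoint]
    · congr 1
      ext x
      simp only [Finset.mem_union, Finset.mem_filter]
      constructor
      · rintro (⟨h1, h2, h3⟩ | ⟨h1, h2⟩)
        · exact ⟨h1, h3⟩
        · exact ⟨h1, h2.trans_le hhc⟩
      · rintro ⟨h1, h2⟩
        rcases lt_or_ge x h with h3 | h3
        · exact Or.inr ⟨h1, h3⟩
        · exact Or.inl ⟨h1, h3, h2⟩
    · rw [Finset.disjoint_filter]
      intro x _ h1 h2
      omega
  -- `b` bins come from pairs and `k` from heads and small items. If `c ≤ n * κ` there are no pairs;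
  -- otherwise each head of the column gets a bin, and `r c + r h = 2 * κ` leaves exactly `2 * b`
  -- items to pair.
  obtain ⟨b, k, hbk, hb, hk, hk'⟩ : ∃ b k, b + k = κ ∧ 2 * b + r h ≤ r c ∧ r h ≤ k ∧
      k - r h = κ - r c := by
    rcases le_or_gt c (n * κ) with hcN | hcN
    · have hhc : h = c := by omega
      have := hmono hcN
      exact ⟨0, κ, by omega, by rw [hhc]; omega, by rw [hhc]; omega, by rw [hhc]⟩
    · have h1 : r c + r h = 2 * κ := count_isSnake_add_count hn (by omega)
      have := hmono hcN.le
      exact ⟨κ - r h, r h, by omega, by omega, by omega, by omega⟩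
  have hcovT : Covers s (S.filter fun x => h ≤ x ∧ x < c) b := by
    refine Covers.of_two_mul_le_card hs.nonneg (fun x hx => ?_) (by omega)
    exact (hc x).1 (Finset.mem_filter.1 hx).2.2
  have hcovHZ : Covers s (S.filter (· < h) ∪ S.filter (c ≤ ·)) k := by
    refine Covers.of_deficit_le hs.nonneg hs.le_one ?_ (fun x hx => ?_) (by omega) ?_
    · rw [Finset.disjoint_filter]
      intro x _ h1 h2
      omega
    · have := (hc x).not.1 (not_lt.2 (Finset.mem_filter.1 hx).2)
      exact not_le.1 this
    · rw [hH, hk']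
      exact hcon
  rw [← hbk]
  refine (hcovT.union ?_ hcovHZ hs.nonneg).mono hs.nonneg ?_
  · rw [Finset.disjoint_union_right, Finset.disjoint_filter, Finset.disjoint_filter]
    exact ⟨fun x _ h1 h2 => by omega, fun x _ h1 h2 => by omega⟩
  · refine Finset.union_subset (Finset.filter_subset _ _) (Finset.union_subset ?_ ?_) <;>
      exact Finset.filter_subset _ _

/-- For an agent whose relevant large items are not yet exhausted: no small item is lost, and `r c +
r h = 2 * κ` ensures that enough large items remain to form pairs. -/
theorem IsSufficient.remove_snake (hs : IsProfile s m)
    (hc : IsSufficient s m ((n + 1) * κ) c) {q : ℕ} (hq : q ≤ min c (2 * ((n + 1) * κ)))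
    (hS : S = (Finset.range q).filter (IsSnake (n + 1))) :
    IsSufficient (fun x => s (Nat.nth (· ∉ S) x)) (Nat.count (· ∉ S) m) (n * κ)
      (Nat.count (· ∉ S) c) := by
  set r := Nat.count (IsSnake (n + 1)) with hr
  have hmono : Monotone r := Nat.count_monotone _
  set N := (n + 1) * κ with hN
  have hNκ : N = n * κ + κ := by rw [hN]; ring
  set N' := n * κ with hN'
  have hcard : ∀ x, (S.filter (· < x)).card = r (min q x) := fun x => by
    rw [hr, Nat.count_eq_card_filter_range, hS, Finset.filter_filter]
    congr 1
    ext y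
    simp only [Finset.mem_filter, Finset.mem_range]
    constructor
    · exact fun h => ⟨by omega, h.2.1⟩
    · exact fun h => ⟨by omega, h.2, by omega⟩
  have h1 : r N + r N = 2 * κ := count_isSnake_add_count n.succ_pos (by omega)
  have h2 : r (2 * N) + r 0 = 2 * κ := count_isSnake_add_count n.succ_pos (by omega)
  obtain ⟨h, hh⟩ : ∃ h, h = min c (2 * N - c) := ⟨_, rfl⟩
  have h3 := count_notMem_add_card S c
  have h4 := count_notMem_add_card S h
  rw [hcard] at h3 h4
  rw [min_eq_left (by omega)] at h3
  have h5 : r q ≤ r c := hmono (by omega)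
  have h6 : r q ≤ r (2 * N) := hmono (by omega)
  have h7 : r (min q h) ≤ r h := hmono (by omega)
  have h8 : r c ≤ r N + (c - N) := count_le_count_add N c
  refine hc.comp_nth hs hh ?_ ?_
  · rcases le_or_gt c N with hcN | hcN
    · have : h = c := by omega
      rw [this]
      exact min_le_left _ _
    · rcases le_or_gt c (2 * N) with hc2 | hc2
      · have h9 : r c + r h = 2 * κ := count_isSnake_add_count n.succ_pos (by omega)
        omega
      · omega
  · have hempty : S.filter (c ≤ ·) = ∅ := by
      rw [Finset.filter_eq_empty_iff, hS]
      intro x hx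
      rw [Finset.mem_filter, Finset.mem_range] at hx
      omega
    rw [hempty, Finset.sum_empty]
    refine add_le_add (Finset.sum_nonneg fun x _ => sub_nonneg.2 (hs.le_one x)) ?_
    rw [Nat.cast_le]
    omega

theorem IsSufficient.remove_of_le (hs : IsProfile s m)
    (hc : IsSufficient s m ((n + 1) * κ) c) (hc2 : c < 2 * ((n + 1) * κ))
    (hh : h = min c (2 * ((n + 1) * κ) - c))
    (hSc : S.filter (· < c) = (Finset.range c).filter (IsSnake (n + 1)))
    (hS : ∑ x ∈ S with c ≤ x, s x ≤
      ∑ x ∈ S with x < h, (1 - s x) + (κ - Nat.count (IsSnake (n + 1)) c : ℕ)) :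
    IsSufficient (fun x => s (Nat.nth (· ∉ S) x)) (Nat.count (· ∉ S) m) (n * κ)
      (Nat.count (· ∉ S) c) := by
  set r := Nat.count (IsSnake (n + 1)) with hr
  have hmono : Monotone r := Nat.count_monotone _
  set N := (n + 1) * κ with hN
  have hNκ : N = n * κ + κ := by rw [hN]; ring
  set N' := n * κ with hN'
  have h1 : r N + r N = 2 * κ := count_isSnake_add_count n.succ_pos (by omega)
  have h3 := count_notMem_add_card S c
  have h4 := count_notMem_add_card S h
  rw [card_filter_lt_of_eq_snake hSc le_rfl, ← hr] at h3
  rw [card_filter_lt_of_eq_snake hSc (by omega), ← hr] at h4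
  have h8 : r c ≤ r N + (c - N) := count_le_count_add N c
  have h9 : r N ≤ r c + (N - c) := count_le_count_add c N
  refine hc.comp_nth hs hh ?_ ?_
  · rcases le_or_gt c N with hcN | hcN
    · have : h = c := by omega
      rw [this]
      exact min_le_left _ _
    · have h9 : r c + r h = 2 * κ := count_isSnake_add_count n.succ_pos (by omega)
      omega
  -- For `c ≤ N` the `N - c` bins without a large item split exactly between this bundle and the
  -- rest; for `c > N` all three differences vanish.
  · have h10 : (κ - r c) + (N' - Nat.count (· ∉ S) c) ≤ N - c := by
      rcases le_or_gt c N with hcN | hcN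
      · have := hmono hcN
        omega
      · have := hmono hcN.le
        omega
    have h11 : ((κ - r c : ℕ) : ℝ) + (N' - Nat.count (· ∉ S) c : ℕ) ≤ (N - c : ℕ) := by
      exact_mod_cast h10
    linarith

end Snake

/-! ### Growing a bundle until some agent is served -/

/-- If the items are sufficient for `n * κ i` bins for each of `n` agents `i`, then they can be
divided among the agents so that every agent `i` covers `κ i` bins. -/
theorem exists_disjoint_covers {ι : Type*} [DecidableEq ι] (n : ℕ) :
    ∀ (A : Finset ι), A.card = n → ∀ (s : ι → ℕ → ℝ) (m : ℕ) (κ : ι → ℕ),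
    (∀ i ∈ A, IsProfile (s i) m) → (∀ i ∈ A, ∃ c, IsSufficient (s i) m (n * κ i) c) →
    ∃ B : ι → Finset ℕ, (A : Set ι).PairwiseDisjoint B ∧ ∀ i ∈ A, Covers (s i) (B i) (κ i) := by
  induction n with
  | zero =>
    intro A hA s m κ _ _
    rw [Finset.card_eq_zero] at hA
    subst hA
    exact ⟨fun _ => ∅, by simp, by simp⟩
  | succ n ih =>
    intro A hA s m κ hs hsuff
    have hn : 0 < n + 1 := n.succ_pos
    choose! c hc using hsuff
    obtain ⟨i₀, hi₀, hD⟩ := Finset.exists_mem_eq_sup A (Finset.card_pos.1 (hA ▸ hn))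
      fun j => min (c j) (2 * ((n + 1) * κ j))
    -- Before `D` only the column is taken, so no agent loses more than a fair share of the relevant
    -- large items; an agent attaining `D` with `c < 2N` receives every small item once `q = m`.
    set D := A.sup fun j => min (c j) (2 * ((n + 1) * κ j)) with hDdef
    have hDle : ∀ j ∈ A, min (c j) (2 * ((n + 1) * κ j)) ≤ D := fun j hj =>
      Finset.le_sup (f := fun j => min (c j) (2 * ((n + 1) * κ j))) hj
    set F : ℕ → Finset ℕ := fun q =>
      (Finset.range q).filter fun x => IsSnake (n + 1) x ∨ D ≤ x with hF
    have hFsnake : ∀ q b, b ≤ q → (Finset.range b).filter (IsSnake (n + 1)) ⊆ F q := by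
      intro q b hbq x hx
      simp only [hF, Finset.mem_filter, Finset.mem_range] at hx ⊢
      exact ⟨by omega, Or.inl hx.2⟩
    have hFlt : ∀ q b, b ≤ q → b ≤ D →
        (F q).filter (· < b) = (Finset.range b).filter (IsSnake (n + 1)) := by
      intro q b hbq hbD
      ext x
      simp only [hF, Finset.mem_filter, Finset.mem_range]
      constructor
      · rintro ⟨⟨_, h1 | h1⟩, h2⟩
        · exact ⟨h2, h1⟩
        · omega
      · exact fun h1 => ⟨⟨by omega, Or.inl h1.2⟩, h1.1⟩
    have hex : ∃ q, ∃ i ∈ A, Covers (s i) (F q) (κ i) := by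
      -- At `q = m` agent `i₀` is served: either pairs from the column suffice, or the bundle holds
      -- all small items, which are enough even for all `(n + 1) * κ i₀` bins.
      refine ⟨m, i₀, hi₀, ?_⟩
      have hcm := (hs i₀ hi₀).threshold_le (hc i₀ hi₀).1
      rcases le_or_gt (2 * ((n + 1) * κ i₀)) (c i₀) with h2 | h2
      · exact covers_of_snake_subset hn (hs i₀ hi₀) (hc i₀ hi₀).1 h2 (hFsnake _ _ (by omega))
      · have hDc : D = c i₀ := by omega
        by_contra hcov
        have hSc := hFlt m (c i₀) hcm hDc.ge
        have hdef := deficit_of_not_covers hn (hs i₀ hi₀) (hc i₀ hi₀).1 h2 rfl hSc hcov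
        have hsum := (hc i₀ hi₀).2
        have h3 : (F m).filter (c i₀ ≤ ·) = Finset.Ico (c i₀) m := by
          ext x
          simp only [hF, Finset.mem_filter, Finset.mem_range, Finset.mem_Ico]
          constructor
          · exact fun h => ⟨h.2, h.1.1⟩
          · exact fun h => ⟨⟨h.2, Or.inr (hDc ▸ h.1)⟩, h.1⟩
        rw [h3] at hdef
        have h4 : ∑ x ∈ F m with x < min (c i₀) (2 * ((n + 1) * κ i₀) - c i₀), (1 - s i₀ x) ≤
            ∑ x ∈ Finset.range (min (c i₀) (2 * ((n + 1) * κ i₀) - c i₀)), (1 - s i₀ x) := by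
          refine Finset.sum_le_sum_of_subset_of_nonneg ?_
            fun x _ _ => sub_nonneg.2 ((hs i₀ hi₀).le_one x)
          intro x hx
          exact Finset.mem_range.2 (Finset.mem_filter.1 hx).2
        have h5 : κ i₀ - Nat.count (IsSnake (n + 1)) (c i₀) ≤ (n + 1) * κ i₀ - c i₀ := by
          have h6 := count_le_count_add (p := IsSnake (n + 1)) (c i₀) ((n + 1) * κ i₀)
          have h7 := count_isSnake_add_count (κ := κ i₀) hn (two_mul ((n + 1) * κ i₀)).symm
          omega
        have h8 : ((κ i₀ - Nat.count (IsSnake (n + 1)) (c i₀) : ℕ) : ℝ) ≤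
            ((n + 1) * κ i₀ - c i₀ : ℕ) := by exact_mod_cast h5
        linarith
    classical
    obtain ⟨q, ⟨i, hi, hcovi⟩, hmin⟩ : ∃ q, (∃ i ∈ A, Covers (s i) (F q) (κ i)) ∧
        ∀ q' < q, ∀ j ∈ A, ¬ Covers (s j) (F q') (κ j) :=
      ⟨Nat.find hex, Nat.find_spec hex, fun q' hq' j hj hcov =>
        Nat.find_min hex hq' ⟨j, hj, hcov⟩⟩
    have hrest : ∀ j ∈ A, IsSufficient (fun x => s j (Nat.nth (· ∉ F q) x))
        (Nat.count (· ∉ F q) m) (n * κ j) (Nat.count (· ∉ F q) (c j)) := by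
      intro j hj
      rcases le_or_gt q (min (c j) (2 * ((n + 1) * κ j))) with hq | hq
      · refine (hc j hj).remove_snake (hs j hj) hq ?_
        rw [← hFlt q q le_rfl (hq.trans (hDle j hj)), Finset.filter_true_of_mem]
        intro x hx
        exact Finset.mem_range.1 (Finset.mem_filter.1 hx).1
      · obtain ⟨p, rfl⟩ : ∃ p, q = p + 1 := ⟨q - 1, by omega⟩
        -- Without the last position `p` agent `j` was not served, so `p` lies beyond the large
        -- items of `j`. The shortage exceeded 1/3, hence adding `p` stays within the share.
        have hncov := hmin p (Nat.lt_succ_self p) j hj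
        have hc2 : c j < 2 * ((n + 1) * κ j) := by
          by_contra h2
          exact hncov (covers_of_snake_subset hn (hs j hj) (hc j hj).1 (not_lt.1 h2)
            (hFsnake _ _ (by omega)))
        have hcD : c j ≤ D := by have := hDle j hj; omega
        have hdef := deficit_of_not_covers hn (hs j hj) (hc j hj).1 hc2 rfl
          (hFlt p (c j) (by omega) hcD) hncov
        refine (hc j hj).remove_of_le (hs j hj) hc2 rfl (hFlt _ (c j) (by omega) hcD) ?_
        have hpc : c j ≤ p := by omega
        have hsp : s j p < 1 / 3 := not_le.1 (((hc j hj).1 p).not.1 (not_lt.2 hpc))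
        have h1 : (F (p + 1)).filter (c j ≤ ·) ⊆ insert p ((F p).filter (c j ≤ ·)) := by
          intro x hx
          simp only [hF, Finset.mem_filter, Finset.mem_range, Finset.mem_insert] at hx ⊢
          rcases eq_or_ne x p with h | h
          · exact Or.inl h
          · exact Or.inr ⟨⟨by omega, hx.1.2⟩, hx.2⟩
        have h2 := Finset.sum_le_sum_of_subset_of_nonneg h1
          fun x _ _ => (hs j hj).nonneg x
        rw [Finset.sum_insert (by simp [hF])] at h2
        have h3 : ∑ x ∈ F p with x < min (c j) (2 * ((n + 1) * κ j) - c j), (1 - s j x) ≤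
            ∑ x ∈ F (p + 1) with x < min (c j) (2 * ((n + 1) * κ j) - c j), (1 - s j x) := by
          refine Finset.sum_le_sum_of_subset_of_nonneg (Finset.filter_subset_filter _ ?_)
            fun x _ _ => sub_nonneg.2 ((hs j hj).le_one x)
          exact Finset.filter_subset_filter _ (Finset.range_mono p.le_succ)
        linarith
    obtain ⟨B, hBd, hBc⟩ := ih (A.erase i) (by rw [Finset.card_erase_of_mem hi, hA]; rfl)
      (fun j x => s j (Nat.nth (· ∉ F q) x)) (Nat.count (· ∉ F q) m) κ
      (fun j hj => (hs j (Finset.mem_of_mem_erase hj)).comp_nth _)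
      (fun j hj => ⟨_, hrest j (Finset.mem_of_mem_erase hj)⟩)
    set e : ℕ ↪ ℕ := ⟨Nat.nth (· ∉ F q), Nat.nth_injective (infinite_setOf_notMem (F q))⟩ with he
    have hdisj : ∀ T : Finset ℕ, Disjoint (F q) (T.map e) := fun T => by
      rw [Finset.disjoint_right]
      intro x hx
      obtain ⟨y, _, rfl⟩ := Finset.mem_map.1 hx
      exact Nat.nth_mem_of_infinite (infinite_setOf_notMem (F q)) y
    refine ⟨fun j => if j = i then F q else (B j).map e, ?_, ?_⟩
    · intro j hj l hl hjl
      simp only [Function.onFun]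
      by_cases hji : j = i
      · have hli : l ≠ i := fun h => hjl (hji.trans h.symm)
        simp only [hji, hli, if_true, if_false]
        exact hdisj _
      · by_cases hli : l = i
        · simp only [hji, hli, if_true, if_false]
          exact (hdisj _).symm
        · simp only [hji, hli, if_false, Finset.disjoint_map]
          exact hBd (Finset.mem_erase.2 ⟨hji, hj⟩) (Finset.mem_erase.2 ⟨hli, hl⟩) hjl
    · intro j hj
      by_cases hji : j = i
      · subst hji
        simpa using hcovi
      · simp only [hji, if_false]
        exact Covers.map e (hBc j (Finset.mem_erase.2 ⟨hji, hj⟩))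

/-! ### From positions back to items -/

/-- Picking in the order of the positions, the owner of every position obtains an item at least
as large as the item at this position in the owner's own order. -/
theorem exists_perm_le {ι : Type*} {m : ℕ} (w : ι → Fin m → ℝ) (σ : ι → Equiv.Perm (Fin m))
    (hσ : ∀ i, Antitone (w i ∘ σ i)) (o : Fin m → ι) :
    ∃ g : Equiv.Perm (Fin m), ∀ p, w (o p) (σ (o p) p) ≤ w (o p) (g p) := by
  classical
  -- Hall's condition for `T` follows from its last position `p` alone: the `p + 1` largest items of
  -- the owner of `p` are all acceptable there.
  obtain ⟨g, hg, hle⟩ := (Finset.all_card_le_biUnion_card_iff_exists_injective fun p : Fin m =>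
    Finset.univ.filter fun e => w (o p) (σ (o p) p) ≤ w (o p) e).1 fun T => by
      rcases T.eq_empty_or_nonempty with rfl | hT
      · simp
      set p := T.max' hT with hp
      calc T.card ≤ (Finset.Iic p).card :=
            Finset.card_le_card fun x hx => Finset.mem_Iic.2 (T.le_max' x hx)
        _ = ((Finset.Iic p).map (σ (o p)).toEmbedding).card := (Finset.card_map _).symm
        _ ≤ _ := Finset.card_le_card fun e he => by
            obtain ⟨x, hx, rfl⟩ := Finset.mem_map.1 he
            rw [Finset.mem_biUnion]
            refine ⟨p, T.max'_mem hT, ?_⟩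
            rw [Finset.mem_filter]
            exact ⟨Finset.mem_univ _, hσ (o p) (Finset.mem_Iic.1 hx)⟩
  refine ⟨Equiv.ofBijective g (Finite.injective_iff_bijective.1 hg), fun p => ?_⟩
  exact (Finset.mem_filter.1 (hle p)).2

namespace BinCoveringInstance

variable {n m : ℕ} (I : BinCoveringInstance n m)

theorem canSplit_of_covers {i : Fin n} {S : Finset (Fin m)} {k : ℕ}
    (h : Covers (I.size i) S k) : I.CanSplit i (2 / 3) k S := by
  intro hk
  obtain ⟨f, hf⟩ := h
  -- Unused labels are redirected to bin 0, since the parts must exhaust `S`.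
  refine ⟨fun j => S.filter fun e => (if f e < k then f e else 0) = j, ⟨?_, ?_⟩, fun j => ?_⟩
  · ext e
    simp only [Finset.mem_biUnion, Finset.mem_univ, true_and, Finset.mem_filter]
    constructor
    · rintro ⟨j, he, _⟩
      exact he
    · intro he
      by_cases hfe : f e < k
      · exact ⟨⟨f e, hfe⟩, he, by simp [hfe]⟩
      · exact ⟨⟨0, hk⟩, he, by simp [hfe]⟩
  · intro j l hjl
    rw [Finset.disjoint_filter]
    intro e _ h1 h2
    exact hjl (Fin.ext (h1.symm.trans h2))
  · refine (hf j j.2).trans (Finset.sum_le_sum_of_subset_of_nonneg ?_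
      fun e _ _ => (I.size_pos i e).le)
    intro e he
    rw [Finset.mem_filter] at he ⊢
    exact ⟨he.1, by simp [he.2]⟩

theorem exists_bins (i : Fin n) : ∃ Q : Fin n × Fin (I.mms i) → Finset (Fin m),
    (Pairwise fun x y => Disjoint (Q x) (Q y)) ∧ ∀ x, 1 ≤ I.bundleSize i (Q x) := by
  obtain ⟨X, ⟨_, hXd⟩, hX⟩ := (I.isGreatest_mms i).1
  have hle : ∀ j, I.mms i ≤ I.value i (X j) := fun j => by
    rw [hX]
    exact ciInf_le (OrderBot.bddBelow _) j
  rcases Nat.eq_zero_or_pos (I.mms i) with h0 | hpos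
  · have : IsEmpty (Fin n × Fin (I.mms i)) := by rw [h0]; infer_instance
    exact ⟨fun _ => ∅, fun x => (IsEmpty.false x).elim, fun x => (IsEmpty.false x).elim⟩
  choose P hP hPs using fun j => (I.isGreatest_value i (X j)).1 (hpos.trans_le (hle j))
  refine ⟨fun x => P x.1 (Fin.castLE (hle x.1) x.2), ?_, fun x => hPs _ _⟩
  rintro ⟨j, a⟩ ⟨l, b⟩ hne
  by_cases hjl : j = l
  · subst hjl
    refine (hP j).2 fun hab => hne ?_
    exact congrArg (Prod.mk j) (Fin.castLE_injective _ hab)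
  · refine (hXd hjl).mono ?_ ?_
    · rw [← (hP j).1]
      exact Finset.subset_biUnion_of_mem (P j) (Finset.mem_univ _)
    · rw [← (hP l).1]
      exact Finset.subset_biUnion_of_mem (P l) (Finset.mem_univ _)

/-- The sizes of the items for agent `i`, listed according to the permutation `σ`. -/
noncomputable def profile (i : Fin n) (σ : Equiv.Perm (Fin m)) (x : ℕ) : ℝ :=
  if h : x < m then I.size i (σ ⟨x, h⟩) else 0

variable {I} {i : Fin n} {σ : Equiv.Perm (Fin m)}

theorem profile_val (p : Fin m) : I.profile i σ p = I.size i (σ p) := by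
  simp [profile]

theorem isProfile_profile (hσ : Antitone (I.size i ∘ σ)) : IsProfile (I.profile i σ) m where
  anti x y hxy := by
    unfold profile
    split_ifs with hy hx hx
    · exact hσ (Fin.mk_le_mk.2 hxy)
    · omega
    · exact (I.size_pos _ _).le
    · exact le_rfl
  nonneg x := by
    unfold profile
    split_ifs
    · exact (I.size_pos _ _).le
    · exact le_rfl
  le_one x := by
    unfold profile
    split_ifs
    · exact I.size_le_one _ _
    · exact zero_le_one
  eq_zero x hx := dif_neg (not_lt.2 hx)

theorem exists_isSufficient_profile (hσ : Antitone (I.size i ∘ σ)) :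
    ∃ c, IsSufficient (I.profile i σ) m (n * I.mms i) c := by
  have hs := isProfile_profile hσ
  obtain ⟨c, hc⟩ := hs.exists_threshold
  obtain ⟨Q, hQd, hQ⟩ := I.exists_bins i
  have := IsSufficient.of_bins hs hc
    (fun x => (Q x).map (σ.symm.toEmbedding.trans Fin.valEmbedding))
    (fun x y hxy => (Finset.disjoint_map _).2 (hQd hxy))
    (fun x y hy => by
      obtain ⟨e, _, rfl⟩ := Finset.mem_map.1 hy
      exact Finset.mem_range.2 (σ.symm e).2)
    (fun x => by
      rw [Finset.sum_map]
      refine (hQ x).trans_eq (Finset.sum_congr rfl fun e _ => ?_)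
      simp [profile_val])
  rw [Fintype.card_prod, Fintype.card_fin, Fintype.card_fin] at this
  exact ⟨c, this⟩

end BinCoveringInstance

theorem mainTheorem1 {n m : ℕ} (hn : 0 < n) (I : BinCoveringInstance n m) :
    ∃ A : Fin n → Finset (Fin m), I.IsCMMSAllocation (2 / 3) A := by
  classical
  have hsort : ∀ i, ∃ σ : Equiv.Perm (Fin m), Antitone (I.size i ∘ σ) := fun i =>
    ⟨Tuple.sort fun e => -I.size i e, fun x y hxy =>
      neg_le_neg_iff.1 (Tuple.monotone_sort (fun e => -I.size i e) hxy)⟩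
  choose σ hσ using hsort
  obtain ⟨B, hBd, hBc⟩ := exists_disjoint_covers n (Finset.univ : Finset (Fin n)) (by simp)
    (fun i => I.profile i (σ i)) m I.mms
    (fun i _ => BinCoveringInstance.isProfile_profile (hσ i))
    (fun i _ => BinCoveringInstance.exists_isSufficient_profile (hσ i))
  have howner : ∃ o : Fin m → Fin n, ∀ (p : Fin m) i, (p : ℕ) ∈ B i → o p = i := by
    -- Positions in no bundle go to agent 0; extra items do no harm.
    refine ⟨fun p => if h : ∃ i, (p : ℕ) ∈ B i then h.choose else ⟨0, hn⟩, fun p i hi => ?_⟩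
    have h : ∃ i, (p : ℕ) ∈ B i := ⟨i, hi⟩
    simp only [h, dite_true]
    by_contra hne
    exact Finset.disjoint_left.1 (hBd (by simp) (by simp) hne) h.choose_spec hi
  obtain ⟨o, ho⟩ := howner
  obtain ⟨g, hg⟩ := exists_perm_le I.size σ hσ o
  refine ⟨fun i => (Finset.univ.filter (o · = i)).map g.toEmbedding, ⟨?_, ?_⟩, fun i => ?_⟩
  · ext e
    simp only [Finset.mem_biUnion, Finset.mem_univ, true_and, iff_true]
    exact ⟨o (g.symm e), Finset.mem_map.2 ⟨g.symm e, by simp, by simp⟩⟩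
  · intro i j hij
    rw [Finset.disjoint_map, Finset.disjoint_filter]
    exact fun p _ h1 h2 => hij (h1.symm.trans h2)
  · refine I.canSplit_of_covers (Covers.map g.toEmbedding ?_)
    obtain ⟨f, hf⟩ := hBc i (Finset.mem_univ i)
    refine ⟨fun p => f p, fun j hj => (hf j hj).trans ?_⟩
    calc ∑ x ∈ B i with f x = j, I.profile i (σ i) x
        ≤ ∑ x ∈ (Finset.univ.filter fun p : Fin m => o p = i ∧ f p = j).map Fin.valEmbedding,
            I.profile i (σ i) x := by
          -- A bundle may contain positions beyond `m`; they have size zero and are dropped.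
          rw [← Finset.sum_filter_of_ne (p := (· < m)) fun x _ hne =>
            not_le.1 fun h => hne (dif_neg (not_lt.2 h))]
          refine Finset.sum_le_sum_of_subset_of_nonneg (fun x hx => ?_)
            fun x _ _ => (BinCoveringInstance.isProfile_profile (hσ i)).nonneg x
          obtain ⟨hx, hxm⟩ := Finset.mem_filter.1 hx
          rw [Finset.mem_filter] at hx
          exact Finset.mem_map.2 ⟨⟨x, hxm⟩,
            Finset.mem_filter.2 ⟨Finset.mem_univ _, ho ⟨x, hxm⟩ i hx.1, hx.2⟩, rfl⟩
      _ ≤ ∑ p ∈ (Finset.univ.filter (o · = i)).filter (fun p : Fin m => f p = j), I.size i (g p) := by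
          rw [Finset.sum_map, Finset.filter_filter]
          refine Finset.sum_le_sum fun p hp => ?_
          have hop := (Finset.mem_filter.1 hp).2.1
          have := hg p
          rw [hop] at this
          exact (BinCoveringInstance.profile_val p).trans_le this
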